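/- Let $p_{[1^33^3]}(n)$ denote the number of partitions of $n$ in which each part that is a multiple of $3$ may appear in any of $6$ colors and each remaining part in any of $3$ colors, with $p_{[1^33^3]}(0)=1$; equivalently, $$\sum_{n=0}^{\infty}p_{[1^33^3]}(n)q^n=\frac{1}{E_1^3E_3^3},\qquad E_m:=\prod_{j\ge 1}(1-q^{mj}).$$ Then for every integer $n\ge 0$, $$p_{[1^33^3]}(5n+3)\equiv 0 \pmod 5.$$ -/

import Mathlib

/-- The number of colors available for the part `m`: a part of size `m` comes in `k` colors if
`r ∤ m`; multiples of `r` come in `k` further colors, so in `2 * k` colors altogether. -/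
def numColors (k r m : ℕ) : ℕ := if r ∣ m then 2 * k else k

/-- A partition of `n` whose parts are colored as described by `numColors k r`: a multiset of
pairs (part, color), in which the parts are positive, the colors of a part `m` are the numbers
`0, …, numColors k r m - 1`, and the parts add up to `n`. -/
@[ext]
structure ColoredPartition (k r n : ℕ) where
  parts : Multiset (ℕ × ℕ)
  parts_pos : ∀ x ∈ parts, 0 < x.1
  color_lt : ∀ x ∈ parts, x.2 < numColors k r x.1
  parts_sum : (parts.map Prod.fst).sum = n

/-- There are finitely many colored partitions of `n`, so that `Nat.card` counts them. -/
instance ColoredPartition.instFinite (k r n : ℕ) : Finite (ColoredPartition k r n) := by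
  have hfin : (Set.Iic (n • (Finset.range (n + 1) ×ˢ Finset.range (2 * k)).val)).Finite :=
    Set.finite_Iic _
  have hmem : ∀ p : ColoredPartition k r n,
      p.parts ∈ Set.Iic (n • (Finset.range (n + 1) ×ˢ Finset.range (2 * k)).val) := by
    intro p
    rw [Set.mem_Iic, Multiset.le_iff_count]
    intro x
    by_cases hx : x ∈ p.parts
    · have hcard : p.parts.card ≤ n := by
        have h := Multiset.card_nsmul_le_sum (s := p.parts.map Prod.fst) (a := 1) (by
          intro y hy
          obtain ⟨z, hz, rfl⟩ := Multiset.mem_map.1 hy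
          exact p.parts_pos z hz)
        rw [p.parts_sum] at h
        simpa using h
      have h1 : x.1 ≤ n := by
        have h := Multiset.single_le_sum (s := p.parts.map Prod.fst) (fun _ _ => Nat.zero_le _)
          x.1 (Multiset.mem_map_of_mem _ hx)
        rwa [p.parts_sum] at h
      have h2 : x.2 < 2 * k := by
        have h := p.color_lt x hx
        unfold numColors at h
        split_ifs at h <;> omega
      have h3 : x ∈ (Finset.range (n + 1) ×ˢ Finset.range (2 * k)).val := by
        rw [Finset.mem_val, Finset.mem_product, Finset.mem_range, Finset.mem_range]
        exact ⟨by omega, h2⟩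
      have h4 := Multiset.one_le_count_iff_mem.2 h3
      have h5 := Multiset.count_le_card x p.parts
      rw [Multiset.count_nsmul]
      nlinarith
    · rw [Multiset.count_eq_zero_of_notMem hx]
      exact Nat.zero_le _
  have : Finite (Set.Iic (n • (Finset.range (n + 1) ×ˢ Finset.range (2 * k)).val)) := hfin
  exact Finite.of_injective
    (fun p => (⟨p.parts, hmem p⟩ :
      Set.Iic (n • (Finset.range (n + 1) ×ˢ Finset.range (2 * k)).val)))
    (fun p q h => ColoredPartition.ext (congrArg Subtype.val h))

/-- The colored partition function `p_{[1^k r^k]}(n)`. -/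
noncomputable def coloredPartitionCount (k r n : ℕ) : ℕ := Nat.card (ColoredPartition k r n)

/-!
Modulo a prime `p` dividing `k + 2`, the generating function `1 / (E₁ ^ k * E₃ ^ k)` is
`E₁ ^ 2 * E₃ ^ 2` times a `p`-th power, and `p`-th powers are series in `q ^ p`. So it suffices that
the coefficients of `q ^ n` in `E₁ ^ 2 * E₃ ^ 2` with `p ∣ 3 * n + 1` vanish modulo `p`.

Let `c(z) = ∑ q ^ (a ^ 2 + a b + b ^ 2 + a + b) z ^ (b - a)` be the two-variable cubic theta
function and `w` a primitive cube root of unity. By the addition formula for theta functions and the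
triple product, `E₁ c(z)` is `z E₃` times the theta functions of `z w⁻¹` and `z w`; hence `c` has a
zero at `z = w`, and its derivative there is `E₁ ^ 2 * E₃ ^ 2` up to a constant. On the other hand,
the terms `q ^ n z ^ d` of `c` satisfy `4 (3 n + 1) = 3 d ^ 2 + y ^ 2` for some `y`. When `-3` is
not a square modulo `p` and `p ∣ 3 * n + 1`, this forces `p ∣ d`, and then such a term has zero
derivative in characteristic `p`.
-/

open PowerSeries Finset Filter Topology

open Ideal (span)

open scoped PowerSeries.WithPiTopology DualNumber

section QPochhammer

variable {R : Type*} [CommRing R]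

theorem smodEq_span_X_pow_iff {n : ℕ} {F G : R⟦X⟧} :
    F ≡ G [SMOD span {(X : R⟦X⟧) ^ n}] ↔ ∀ m < n, coeff m F = coeff m G := by
  simp only [SModEq.sub_mem, Ideal.mem_span_singleton, X_pow_dvd_iff, map_sub, sub_eq_zero]

theorem smodEq_X_pow_of_le {m n : ℕ} (h : m ≤ n) {F G : R⟦X⟧}
    (hFG : F ≡ G [SMOD span {(X : R⟦X⟧) ^ n}]) : F ≡ G [SMOD span {(X : R⟦X⟧) ^ m}] :=
  hFG.mono ((Ideal.span_singleton_le_span_singleton).2 (pow_dvd_pow X h))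

theorem smodEq_zero_of_X_pow_dvd {n : ℕ} {F : R⟦X⟧} (h : X ^ n ∣ F) :
    F ≡ 0 [SMOD span {(X : R⟦X⟧) ^ n}] :=
  SModEq.zero.2 (Ideal.mem_span_singleton.2 h)

theorem eq_of_forall_smodEq {F G : R⟦X⟧}
    (h : ∀ n : ℕ, F ≡ G [SMOD span {(X : R⟦X⟧) ^ n}]) : F = G := by
  ext n
  exact smodEq_span_X_pow_iff.1 (h (n + 1)) n n.lt_succ_self

theorem X_pow_dvd_pow {Q : R⟦X⟧} (hQ : X ∣ Q) {m n : ℕ} (h : m ≤ n) : X ^ m ∣ Q ^ n :=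
  (pow_dvd_pow X h).trans (pow_dvd_pow_of_dvd hQ n)

/-- The `q`-Pochhammer symbol `(a; Q)_∞`, that is, the infinite product `∏ (1 - a * Q ^ i)` over
`i ≥ 0`, where `X ∣ Q`: the coefficient of `X ^ n` is then already that of the product of the
factors with `i ≤ n`. -/
noncomputable def qPoch (a Q : R⟦X⟧) : R⟦X⟧ :=
  PowerSeries.mk fun n => coeff n (∏ i ∈ range (n + 1), (1 - a * Q ^ i))

theorem prod_range_smodEq_prod_range {a Q : R⟦X⟧} {k : ℕ} (ha : X ^ k ∣ a) (hQ : X ∣ Q) {m n : ℕ}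
    (h : m ≤ n) :
    ∏ i ∈ range n, (1 - a * Q ^ i) ≡ ∏ i ∈ range m, (1 - a * Q ^ i)
      [SMOD span {(X : R⟦X⟧) ^ (k + m)}] := by
  obtain ⟨l, rfl⟩ := Nat.exists_eq_add_of_le h
  have htail : ∏ i ∈ range l, (1 - a * Q ^ (m + i)) ≡ ∏ i ∈ range l, (1 - 0)
      [SMOD span {(X : R⟦X⟧) ^ (k + m)}] := by
    refine SModEq.prod fun i _ => SModEq.rfl.sub (smodEq_zero_of_X_pow_dvd ?_)
    rw [pow_add]
    exact mul_dvd_mul ha (X_pow_dvd_pow hQ (Nat.le_add_right m i))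
  rw [prod_range_add]
  simpa using SModEq.rfl.mul htail

theorem qPoch_smodEq_prod_range {a Q : R⟦X⟧} (hQ : X ∣ Q) (n : ℕ) :
    qPoch a Q ≡ ∏ i ∈ range n, (1 - a * Q ^ i) [SMOD span {(X : R⟦X⟧) ^ n}] := by
  refine smodEq_span_X_pow_iff.2 fun m hm => ?_
  rw [qPoch, coeff_mk]
  exact (smodEq_span_X_pow_iff.1
    (prod_range_smodEq_prod_range (k := 0) (by simp) hQ hm) m (by omega)).symm

theorem qPoch_smodEq_one {a Q : R⟦X⟧} {k : ℕ} (ha : X ^ k ∣ a) (hQ : X ∣ Q) :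
    qPoch a Q ≡ 1 [SMOD span {(X : R⟦X⟧) ^ k}] := by
  have h := prod_range_smodEq_prod_range ha hQ k.zero_le
  rw [prod_range_zero] at h
  exact (qPoch_smodEq_prod_range hQ k).trans h

theorem eq_qPoch_of_forall_smodEq {a Q F : R⟦X⟧} (hQ : X ∣ Q) {k : ℕ} (hk : 0 < k)
    (h : ∀ n, F ≡ ∏ i ∈ range (k * n), (1 - a * Q ^ i) [SMOD span {(X : R⟦X⟧) ^ n}]) :
    F = qPoch a Q :=
  eq_of_forall_smodEq fun n => (h n).trans
    (smodEq_X_pow_of_le (Nat.le_mul_of_pos_left n hk) (qPoch_smodEq_prod_range hQ _)).symm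

theorem qPoch_eq_one_sub_mul {a Q : R⟦X⟧} (hQ : X ∣ Q) :
    qPoch a Q = (1 - a) * qPoch (a * Q) Q := by
  refine eq_of_forall_smodEq fun n => ?_
  have h := smodEq_X_pow_of_le n.le_succ (qPoch_smodEq_prod_range (a := a) hQ (n + 1))
  rw [prod_range_succ'] at h
  simp only [pow_succ', pow_zero, mul_one, ← mul_assoc, mul_comm _ (1 - a)] at h
  exact h.trans (SModEq.rfl.mul (qPoch_smodEq_prod_range hQ n).symm)

theorem prod_range_qPoch {a Q : R⟦X⟧} (hQ : X ∣ Q) {k : ℕ} (hk : 0 < k) :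
    ∏ r ∈ range k, qPoch (a * Q ^ r) (Q ^ k) = qPoch a Q := by
  refine eq_qPoch_of_forall_smodEq hQ hk fun n => ?_
  have hprod : ∏ r ∈ range k, ∏ i ∈ range n, (1 - a * Q ^ r * (Q ^ k) ^ i)
      = ∏ i ∈ range (k * n), (1 - a * Q ^ i) := by
    rw [Finset.prod_comm]
    induction n with
    | zero => simp
    | succ n ih =>
      rw [prod_range_succ, ih, Nat.mul_succ, prod_range_add]
      simp only [mul_assoc, ← pow_mul, ← pow_add, add_comm]
  rw [← hprod]
  exact SModEq.prod fun r _ => qPoch_smodEq_prod_range (hQ.trans (dvd_pow_self Q hk.ne')) n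

theorem prod_qPoch_mul_left {ι : Type*} {s : Finset ι} {w : ι → R⟦X⟧} {n : ℕ} (hn : 0 < n)
    (hw : ∀ t, ∏ j ∈ s, (1 - w j * t) = 1 - t ^ n) {a Q : R⟦X⟧} (hQ : X ∣ Q) :
    ∏ j ∈ s, qPoch (w j * a) Q = qPoch (a ^ n) (Q ^ n) := by
  refine eq_qPoch_of_forall_smodEq (hQ.trans (dvd_pow_self Q hn.ne')) one_pos fun N => ?_
  have hprod : ∏ j ∈ s, ∏ i ∈ range N, (1 - w j * a * Q ^ i)
      = ∏ i ∈ range (1 * N), (1 - a ^ n * (Q ^ n) ^ i) := by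
    rw [Finset.prod_comm, one_mul]
    simp only [mul_assoc, hw, mul_pow, ← pow_mul, mul_comm n]
  rw [← hprod]
  exact SModEq.prod fun j _ => qPoch_smodEq_prod_range hQ N

theorem map_qPoch {S : Type*} [CommRing S] (f : R →+* S) (a Q : R⟦X⟧) :
    (qPoch a Q).map f = qPoch (a.map f) (Q.map f) := by
  ext n
  simp only [qPoch, coeff_map, coeff_mk, ← map_pow, ← map_mul, ← map_one (PowerSeries.map f),
    ← map_sub, ← map_prod]

theorem isUnit_qPoch {a Q : R⟦X⟧} (ha : X ∣ a) : IsUnit (qPoch a Q) := by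
  have ha0 : constantCoeff a = 0 := X_dvd_iff.1 ha
  rw [isUnit_iff_constantCoeff, ← coeff_zero_eq_constantCoeff_apply, qPoch, coeff_mk]
  simp [ha0]

theorem qPoch_mul_qPoch_neg {a Q : R⟦X⟧} (hQ : X ∣ Q) :
    qPoch a Q * qPoch (-a) Q = qPoch (a ^ 2) (Q ^ 2) := by
  have h := prod_qPoch_mul_left (s := univ) (w := ![(1 : R⟦X⟧), -1]) two_pos (fun t => by
    simp only [Fin.prod_univ_two, Matrix.cons_val_zero, Matrix.cons_val_one]; ring) (a := a) hQ
  simpa [Fin.prod_univ_two] using h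

theorem qPoch_mul_cube_roots {a Q w : R⟦X⟧} (hQ : X ∣ Q) (hw : 1 + w + w ^ 2 = 0) :
    qPoch a Q * qPoch (w * a) Q * qPoch (w ^ 2 * a) Q = qPoch (a ^ 3) (Q ^ 3) := by
  rw [← prod_qPoch_mul_left (s := range 3) (w := fun j => w ^ j) three_pos (fun t => ?_) hQ]
  · simp [prod_range_succ]
  · simp only [prod_range_succ, prod_range_zero, pow_zero, pow_one]
    linear_combination (t - w * t ^ 2 + (w - 1) * t ^ 3) * -hw

/-- The product `E_m = ∏ (1 - q ^ (m * j))` over `j ≥ 1`, as a power series in `q = X`. -/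
noncomputable def eulerProd (R : Type*) [CommRing R] (m : ℕ) : R⟦X⟧ := qPoch (X ^ m) (X ^ m)

theorem isUnit_eulerProd {m : ℕ} (hm : 0 < m) : IsUnit (eulerProd R m) :=
  isUnit_qPoch (dvd_pow_self X hm.ne')

theorem map_eulerProd {S : Type*} [CommRing S] (f : R →+* S) (m : ℕ) :
    (eulerProd R m).map f = eulerProd S m := by
  simp [eulerProd, map_qPoch]

end QPochhammer

section TripleProduct

/-- The triangular number `m (m + 1) / 2` of an integer. -/
def tri (m : ℤ) : ℕ := (m * (m + 1) / 2).toNat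

theorem two_mul_tri (m : ℤ) : 2 * (tri m : ℤ) = m * (m + 1) := by
  have h0 : 0 ≤ m * (m + 1) := by
    rcases le_or_gt 0 m with h | h
    · positivity
    · nlinarith
  have h1 : 2 ∣ m * (m + 1) := (Int.even_mul_succ_self m).two_dvd
  unfold tri
  omega

theorem tri_add_one (m : ℤ) : (tri (m + 1) : ℤ) = tri m + m + 1 := by
  linarith [two_mul_tri m, two_mul_tri (m + 1)]

theorem tri_neg (m : ℤ) : tri (-m) = tri (m - 1) := by
  zify
  linarith [two_mul_tri (-m), two_mul_tri (m - 1)]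

theorem abs_le_tri_add_one (m : ℤ) : |m| ≤ tri m + 1 := by
  have h := two_mul_tri m
  rw [abs_le]
  constructor <;> nlinarith

section Finite

variable {A : Type*} [CommRing A]

/-- The summands `a ^ (m (m + 1) / 2) * b ^ (m (m - 1) / 2)` of Ramanujan's theta function
`f(a, b)`. -/
def thetaTerm (a b : A) (m : ℤ) : A := a ^ tri m * b ^ tri (m - 1)

theorem thetaTerm_swap (a b : A) (m : ℤ) : thetaTerm b a m = thetaTerm a b (-m) := by
  rw [thetaTerm, thetaTerm, tri_neg, ← neg_add', tri_neg, add_sub_cancel_right, mul_comm]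

theorem mul_pow_mul_thetaTerm (a b : A) {M j : ℕ} {m : ℤ} (h : j + m = M) :
    a * (a * b) ^ M * thetaTerm a b m = (a * b) ^ j * thetaTerm a b (m + 1) := by
  have h1 := tri_add_one m
  have h2 := tri_add_one (m - 1)
  rw [sub_add_cancel] at h2
  calc a * (a * b) ^ M * thetaTerm a b m = a ^ (1 + M + tri m) * b ^ (M + tri (m - 1)) := by
        unfold thetaTerm; ring
    _ = a ^ (j + tri (m + 1)) * b ^ (j + tri m) := by congr 2 <;> omega
    _ = (a * b) ^ j * thetaTerm a b (m + 1) := by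
        unfold thetaTerm; rw [add_sub_cancel_right]; ring

theorem sum_antidiagonal_thetaTerm_swap (a b : A) (g : ℕ → A) (M N : ℕ) :
    ∑ x ∈ antidiagonal (N + M), g x.1 * g x.2 * thetaTerm b a (x.1 - M)
      = ∑ x ∈ antidiagonal (M + N), g x.1 * g x.2 * thetaTerm a b (x.1 - N) := by
  rw [add_comm N, ← Finset.Nat.sum_antidiagonal_swap]
  refine sum_congr rfl fun x hx => ?_
  have hx' := mem_antidiagonal.1 hx
  rw [thetaTerm_swap, Prod.fst_swap, Prod.snd_swap, mul_comm (g x.2)]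
  congr 2
  omega

variable {a b : A} {g : ℕ → A}

theorem one_add_mul_sum_antidiagonal_thetaTerm
    (hg : ∀ k, g (k + 1) * (1 - (a * b) ^ (k + 1)) = g k) (M N : ℕ) :
    (1 + a * (a * b) ^ M) *
        ∑ x ∈ antidiagonal (M + N), g x.1 * g x.2 * thetaTerm a b (x.1 - N)
      = (1 - (a * b) ^ (M + N + 1)) *
        ∑ x ∈ antidiagonal (M + N + 1), g x.1 * g x.2 * thetaTerm a b (x.1 - N) := by
  have hsplit : (1 - (a * b) ^ (M + N + 1)) *
        ∑ x ∈ antidiagonal (M + N + 1), g x.1 * g x.2 * thetaTerm a b (x.1 - N)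
      = ∑ x ∈ antidiagonal (M + N + 1),
          g x.1 * (g x.2 * (1 - (a * b) ^ x.2)) * thetaTerm a b (x.1 - N)
        + ∑ x ∈ antidiagonal (M + N + 1),
          (a * b) ^ x.2 * (g x.1 * (1 - (a * b) ^ x.1)) * g x.2 * thetaTerm a b (x.1 - N) := by
    rw [mul_sum, ← sum_add_distrib]
    refine sum_congr rfl fun x hx => ?_
    rw [← mem_antidiagonal.1 hx, pow_add]
    ring
  rw [hsplit, Finset.Nat.sum_antidiagonal_succ', Finset.Nat.sum_antidiagonal_succ]
  simp only [hg, pow_zero, sub_self, mul_zero, zero_mul, zero_add]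
  rw [mul_sum, ← sum_add_distrib]
  refine sum_congr rfl fun x hx => ?_
  have hshift := mul_pow_mul_thetaTerm a b (M := M) (j := x.2) (m := x.1 - N) (by
    have := mem_antidiagonal.1 hx; omega)
  rw [show ((x.1 + 1 : ℕ) : ℤ) - N = x.1 - N + 1 by push_cast; ring]
  linear_combination g x.1 * g x.2 * hshift

theorem finite_triple_product (hg : ∀ k, g (k + 1) * (1 - (a * b) ^ (k + 1)) = g k) (M N : ℕ) :
    (∏ i ∈ range M, (1 + a * (a * b) ^ i)) * (∏ i ∈ range N, (1 + b * (a * b) ^ i)) *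
        (g 0 * g 0)
      = (∏ i ∈ range (M + N), (1 - (a * b) ^ (i + 1))) *
        ∑ x ∈ antidiagonal (M + N), g x.1 * g x.2 * thetaTerm a b (x.1 - N) := by
  induction M with
  | succ M ih =>
    rw [add_right_comm, prod_range_succ, prod_range_succ, mul_assoc _ (1 - _),
      ← one_add_mul_sum_antidiagonal_thetaTerm hg]
    linear_combination (1 + a * (a * b) ^ M) * ih
  | zero =>
    induction N with
    | zero => simp [thetaTerm, tri]
    | succ N ih =>
      have hstep := one_add_mul_sum_antidiagonal_thetaTerm (a := b) (b := a) (g := g)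
        (by simpa only [mul_comm b a] using hg) N 0
      rw [sum_antidiagonal_thetaTerm_swap a b g 0 N, add_right_comm,
        sum_antidiagonal_thetaTerm_swap a b g 0 (N + 1), mul_comm b a] at hstep
      rw [prod_range_succ, ← add_assoc, prod_range_succ, mul_assoc _ (1 - _), zero_add, add_zero]
        at *
      rw [← hstep]
      linear_combination (1 + b * (a * b) ^ N) * ih

end Finite

variable {R : Type*} [CommRing R] {a b : R⟦X⟧}

/-- Ramanujan's theta function `f(a, b)`, defined by its product form
`(-a; ab)_∞ (-b; ab)_∞ (ab; ab)_∞`. -/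
noncomputable def ramanujanTheta (a b : R⟦X⟧) : R⟦X⟧ :=
  qPoch (-a) (a * b) * qPoch (-b) (a * b) * qPoch (a * b) (a * b)

theorem X_pow_dvd_thetaTerm (h : X ∣ a * b) {d : ℕ} {m : ℤ} (hm : (d : ℤ) < |m|) :
    X ^ d ∣ thetaTerm a b m := by
  have hd : d ≤ min (tri m) (tri (m - 1)) := by
    have h1 := abs_le_tri_add_one m
    have h2 := abs_le_tri_add_one (-m)
    rw [abs_neg, tri_neg] at h2
    omega
  have hmin : (a * b) ^ min (tri m) (tri (m - 1)) ∣ thetaTerm a b m := by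
    rw [mul_pow]
    exact mul_dvd_mul (pow_dvd_pow _ (min_le_left _ _)) (pow_dvd_pow _ (min_le_right _ _))
  exact (X_pow_dvd_pow h hd).trans hmin

theorem sum_antidiagonal_sub_eq_sum_Icc {M : Type*} [AddCommMonoid M] (f : ℤ → M) (N : ℕ) :
    ∑ x ∈ antidiagonal (N + N), f (x.1 - N) = ∑ m ∈ Icc (-(N : ℤ)) N, f m := by
  refine sum_bij (fun x _ => (x.1 : ℤ) - N) ?_ ?_ ?_ fun _ _ => rfl
  · intro x hx
    have := mem_antidiagonal.1 hx
    rw [Finset.mem_Icc]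
    omega
  · intro x hx y hy hxy
    have := mem_antidiagonal.1 hx
    have := mem_antidiagonal.1 hy
    exact Prod.ext (by omega) (by omega)
  · intro m hm
    rw [Finset.mem_Icc] at hm
    exact ⟨((m + N).toNat, (N - m).toNat), mem_antidiagonal.2 (by dsimp only; omega),
      by dsimp only; omega⟩

theorem sum_antidiagonal_thetaTerm_smodEq (h : X ∣ a * b) {g : ℕ → R⟦X⟧} {d N : ℕ}
    (hN : 2 * d ≤ N) (hg : ∀ k, d ≤ k → g k ≡ 1 [SMOD span {(X : R⟦X⟧) ^ d}]) :
    ∑ x ∈ antidiagonal (N + N), g x.1 * g x.2 * thetaTerm a b (x.1 - N)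
      ≡ ∑ m ∈ Icc (-(N : ℤ)) N, thetaTerm a b m [SMOD span {(X : R⟦X⟧) ^ d}] := by
  rw [← sum_antidiagonal_sub_eq_sum_Icc]
  refine SModEq.sum fun x hx => ?_
  have hx' := mem_antidiagonal.1 hx
  by_cases hd : (d : ℤ) < |(x.1 : ℤ) - N|
  · have h0 := smodEq_zero_of_X_pow_dvd (X_pow_dvd_thetaTerm h hd)
    exact (SModEq.rfl.mul h0).trans (by rw [mul_zero]; exact h0.symm)
  · have hd' := abs_le.1 (not_lt.1 hd)
    simpa only [one_mul] using
      ((hg x.1 (by omega)).mul (hg x.2 (by omega))).mul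
        (SModEq.refl (thetaTerm a b ((x.1 : ℤ) - N)))

theorem ramanujanTheta_smodEq_sum_Icc (h : X ∣ a * b) {d N : ℕ} (hN : 2 * d ≤ N) :
    ramanujanTheta a b ≡ ∑ m ∈ Icc (-(N : ℤ)) N, thetaTerm a b m
      [SMOD span {(X : R⟦X⟧) ^ d}] := by
  set Q := a * b
  set g : ℕ → R⟦X⟧ := fun k => qPoch (Q ^ (k + 1)) Q
  have hg : ∀ k, g (k + 1) * (1 - Q ^ (k + 1)) = g k := fun k => by
    simp only [g, pow_succ Q (k + 1), mul_comm _ (1 - Q ^ (k + 1))]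
    exact (qPoch_eq_one_sub_mul h).symm
  have hg1 : ∀ k, d ≤ k → g k ≡ 1 [SMOD span {(X : R⟦X⟧) ^ d}] := fun k hk =>
    qPoch_smodEq_one (X_pow_dvd_pow h (by omega)) h
  have hg0 : g 0 = qPoch Q Q := by simp only [g, zero_add, pow_one]
  obtain ⟨v, hv⟩ := (isUnit_qPoch h (Q := Q)).exists_left_inv
  have hprod (c : R⟦X⟧) {n : ℕ} (hn : d ≤ n) :=
    smodEq_X_pow_of_le hn (qPoch_smodEq_prod_range (a := c) h n)
  have hfin := finite_triple_product hg N N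
  have hL := ((hprod (-a) (n := N) (by omega)).mul (hprod (-b) (n := N) (by omega))).mul
    (SModEq.refl (g 0 * g 0))
  simp only [neg_mul, sub_neg_eq_add] at hL
  rw [hfin, hg0] at hL
  have hR := (hprod Q (n := N + N) (by omega)).symm.mul (sum_antidiagonal_thetaTerm_smodEq h hN hg1)
  simp only [← pow_succ'] at hR
  have hcancel := (SModEq.refl v).mul (hL.trans hR)
  rw [← mul_assoc v (qPoch Q Q), hv, one_mul] at hcancel
  have hθ : ramanujanTheta a b
      = v * (qPoch (-a) Q * qPoch (-b) Q * (qPoch Q Q * qPoch Q Q)) := by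
    rw [ramanujanTheta]
    linear_combination -(qPoch (-a) Q * qPoch (-b) Q * qPoch Q Q) * hv
  rwa [hθ]

theorem sum_thetaTerm_smodEq_ramanujanTheta (h : X ∣ a * b) {d : ℕ} {s : Finset ℤ}
    (hs : Icc (-(d : ℤ)) d ⊆ s) :
    ∑ m ∈ s, thetaTerm a b m ≡ ramanujanTheta a b [SMOD span {(X : R⟦X⟧) ^ d}] := by
  have htail (t : Finset ℤ) (ht : Icc (-(d : ℤ)) d ⊆ t) : ∑ m ∈ t, thetaTerm a b m
      ≡ ∑ m ∈ Icc (-(d : ℤ)) d, thetaTerm a b m [SMOD span {(X : R⟦X⟧) ^ d}] := by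
    refine SModEq.sub_mem.2 (Ideal.mem_span_singleton.2 ?_)
    rw [← sum_sdiff ht, add_sub_cancel_right]
    refine dvd_sum fun m hm => X_pow_dvd_thetaTerm h ?_
    rw [Finset.mem_sdiff, Finset.mem_Icc, ← abs_le] at hm
    exact not_le.1 hm.2
  refine (htail s hs).trans (SModEq.symm ?_)
  exact (ramanujanTheta_smodEq_sum_Icc h (N := 2 * d) le_rfl).trans
    (htail _ (Finset.Icc_subset_Icc (by omega) (by omega)))

theorem jacobi_triple_product [TopologicalSpace R] (h : X ∣ a * b) :
    HasSum (thetaTerm a b) (ramanujanTheta a b) := by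
  rw [WithPiTopology.hasSum_iff_hasSum_coeff]
  intro d
  refine tendsto_const_nhds.congr' ?_
  filter_upwards [eventually_ge_atTop (Icc (-((d + 1 : ℕ) : ℤ)) (d + 1 : ℕ))] with s hs
  rw [← map_sum]
  exact (smodEq_span_X_pow_iff.1 (sum_thetaTerm_smodEq_ramanujanTheta h hs) d d.lt_succ_self).symm

end TripleProduct

section Theta

variable {R : Type*} [CommRing R]

/-- The exponent `α m (m + 1) / 2 + β m (m - 1) / 2` of `q` in the theta series `theta α β`. -/
def thetaExp (α β : ℕ) (m : ℤ) : ℕ := α * tri m + β * tri (m - 1)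

theorem two_mul_thetaExp (α β : ℕ) (m : ℤ) :
    2 * (thetaExp α β m : ℤ) = α * (m * (m + 1)) + β * (m * (m - 1)) := by
  rw [thetaExp]
  push_cast
  linear_combination α * two_mul_tri m + β * two_mul_tri (m - 1)

theorem finite_thetaExp_le {α : ℕ} (hα : α ≠ 0) (β n : ℕ) : {m | thetaExp α β m ≤ n}.Finite := by
  refine (Set.finite_Icc (-(n + 1 : ℤ)) (n + 1)).subset fun m hm => ?_
  have htri : tri m ≤ n := ((Nat.le_mul_of_pos_left _ (Nat.pos_of_ne_zero hα)).trans
    (Nat.le_add_right _ _)).trans hm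
  have habs := abs_le_tri_add_one m
  rw [Set.mem_Icc, ← abs_le]
  omega

/-- The theta function `f(u q ^ α, u⁻¹ q ^ β) = ∑ u ^ m q ^ (thetaExp α β m)` over integers `m`, as
a power series in `q = X`. -/
noncomputable def theta (α β : ℕ) (u : Rˣ) : R⟦X⟧ :=
  ramanujanTheta (monomial α (u : R)) (monomial β ((u⁻¹ : Rˣ) : R))

theorem theta_eq_qPoch_mul (α β : ℕ) (u : Rˣ) :
    theta α β u = qPoch (-(C (u : R) * X ^ α)) (X ^ (α + β)) *
      qPoch (-(C ((u⁻¹ : Rˣ) : R) * X ^ β)) (X ^ (α + β)) * eulerProd R (α + β) := by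
  rw [theta, ramanujanTheta, monomial_mul_monomial, Units.mul_inv, ← X_pow_eq, eulerProd,
    monomial_eq_C_mul_X_pow, monomial_eq_C_mul_X_pow]

theorem thetaTerm_monomial (α β : ℕ) (u : Rˣ) (m : ℤ) :
    thetaTerm (monomial α (u : R)) (monomial β ((u⁻¹ : Rˣ) : R)) m
      = monomial (thetaExp α β m) ((u ^ m : Rˣ) : R) := by
  have hu : u ^ tri m * u⁻¹ ^ tri (m - 1) = u ^ m := by
    have h := tri_add_one (m - 1)
    rw [sub_add_cancel] at h
    rw [← zpow_natCast, ← zpow_natCast, inv_zpow', ← zpow_add]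
    congr 1
    omega
  rw [thetaTerm, monomial_pow, monomial_pow, monomial_mul_monomial, ← hu, thetaExp, mul_comm α,
    mul_comm β]
  push_cast
  rfl

theorem hasSum_theta [TopologicalSpace R] {α : ℕ} (hα : α ≠ 0) (β : ℕ) (u : Rˣ) :
    HasSum (fun m : ℤ => monomial (thetaExp α β m) ((u ^ m : Rˣ) : R)) (theta α β u) := by
  simp only [← thetaTerm_monomial]
  refine jacobi_triple_product ?_
  rw [monomial_mul_monomial, Units.mul_inv, ← X_pow_eq]
  exact dvd_pow_self X (by omega)

theorem summable_monomial [TopologicalSpace R] {ι : Type*} {e : ι → ℕ}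
    (he : ∀ n, {i | e i ≤ n}.Finite) (c : ι → R) : Summable fun i => monomial (e i) (c i) := by
  rw [WithPiTopology.summable_iff_summable_coeff]
  intro n
  refine summable_of_hasFiniteSupport ((he n).subset fun i hi => ?_)
  rw [Function.mem_support, coeff_monomial] at hi
  exact (of_not_not fun h => hi (if_neg h) : n = e i).ge

theorem hasSum_theta_mul_theta [TopologicalSpace R] [IsTopologicalRing R] [T2Space R] {α γ : ℕ}
    (hα : α ≠ 0) (hγ : γ ≠ 0) (β δ : ℕ) (u v : Rˣ) :
    HasSum (fun x : ℤ × ℤ =>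
        monomial (thetaExp α β x.1 + thetaExp γ δ x.2) ((u ^ x.1 * v ^ x.2 : Rˣ) : R))
      (theta α β u * theta γ δ v) := by
  have hfin (n : ℕ) : {x : ℤ × ℤ | thetaExp α β x.1 + thetaExp γ δ x.2 ≤ n}.Finite :=
    ((finite_thetaExp_le hα β n).prod (finite_thetaExp_le hγ δ n)).subset fun _ hx =>
      ⟨(Nat.le_add_right _ _).trans hx, (Nat.le_add_left _ _).trans hx⟩
  have hmul (x : ℤ × ℤ) :
      (monomial (thetaExp α β x.1 + thetaExp γ δ x.2) ((u ^ x.1 * v ^ x.2 : Rˣ) : R) : R⟦X⟧)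
        = monomial (thetaExp α β x.1) ((u ^ x.1 : Rˣ) : R) *
          monomial (thetaExp γ δ x.2) ((v ^ x.2 : Rˣ) : R) := by
    rw [monomial_mul_monomial, Units.val_mul]
  have hsum := (summable_monomial hfin fun x => ((u ^ x.1 * v ^ x.2 : Rˣ) : R)).congr hmul
  exact (HasSum.mul (hasSum_theta hα β u) (hasSum_theta hγ δ v) hsum).congr_fun hmul

theorem coeff_C_mul_theta_mul_theta_congr {α γ : ℕ} (hα : α ≠ 0) (hγ : γ ≠ 0) {β δ n : ℕ}
    {c c' : R} {u u' : Rˣ} (v : Rˣ)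
    (h : ∀ i m, thetaExp α β i + thetaExp γ δ m = n →
      c * ((u ^ i : Rˣ) : R) = c' * ((u' ^ i : Rˣ) : R)) :
    coeff n (C c * (theta α β u * theta γ δ v))
      = coeff n (C c' * (theta α β u' * theta γ δ v)) := by
  let _ : TopologicalSpace R := ⊥
  have _ : DiscreteTopology R := ⟨rfl⟩
  have hsum (d : R) (t : Rˣ) := (WithPiTopology.hasSum_iff_hasSum_coeff R).1
    ((hasSum_theta_mul_theta hα hγ β δ t v).mul_left (C d)) n
  refine (hsum c u).unique ((hsum c' u').congr_fun fun x => ?_)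
  rw [coeff_C_mul, coeff_C_mul, coeff_monomial, coeff_monomial]
  split_ifs with hn
  · rw [Units.val_mul, Units.val_mul, ← mul_assoc, ← mul_assoc, h x.1 x.2 hn.symm]
  · rw [mul_zero, mul_zero]

theorem isCompl_range_add_sub :
    IsCompl (Set.range fun x : ℤ × ℤ => (x.1 + x.2, x.1 - x.2))
      (Set.range fun x : ℤ × ℤ => (x.1 + x.2, x.1 - x.2 - 1)) := by
  constructor
  · rw [Set.disjoint_left]
    rintro _ ⟨x, rfl⟩ ⟨y, hy⟩
    simp only [Prod.mk.injEq] at hy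
    omega
  · rw [codisjoint_iff_le_sup]
    rintro ⟨a, b⟩ -
    rcases Int.even_or_odd' (a + b) with ⟨k, hk | hk⟩
    · exact Or.inl ⟨(k, a - k), by ext <;> simp; omega⟩
    · exact Or.inr ⟨(k + 1, a - k - 1), by ext <;> simp; omega⟩

theorem hasSum_theta_two_zero_mul_theta_one_one [TopologicalSpace R] [IsTopologicalRing R]
    [T2Space R] (x y : Rˣ) :
    HasSum (fun p : ℤ × ℤ => monomial (thetaExp 1 0 (p.1 + p.2) + thetaExp 1 0 (p.1 - p.2))
        (((-x) ^ (p.1 + p.2) * (-y) ^ (p.1 - p.2) : Rˣ) : R))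
      (theta 2 0 (x * y) * theta 1 1 (x / y)) := by
  refine (hasSum_theta_mul_theta two_ne_zero one_ne_zero 0 1 (x * y) (x / y)).congr_fun fun p => ?_
  have hexp : thetaExp 1 0 (p.1 + p.2) + thetaExp 1 0 (p.1 - p.2)
      = thetaExp 2 0 p.1 + thetaExp 1 1 p.2 := by
    have := two_mul_thetaExp 1 0 (p.1 + p.2)
    have := two_mul_thetaExp 1 0 (p.1 - p.2)
    have := two_mul_thetaExp 2 0 p.1
    have := two_mul_thetaExp 1 1 p.2
    zify
    push_cast at *
    linarith
  have hsign : (-1 : Rˣ) ^ (p.1 + p.2) * (-1) ^ (p.1 - p.2) = 1 := by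
    rw [← zpow_add]
    exact Even.neg_one_zpow ⟨p.1, by ring⟩
  rw [hexp, ← neg_one_mul x, ← neg_one_mul y, mul_zpow, mul_zpow, mul_mul_mul_comm, hsign, one_mul,
    zpow_add, zpow_sub, mul_mul_mul_comm, ← mul_zpow, ← div_eq_mul_inv, ← div_zpow]

theorem hasSum_neg_C_mul_theta_one_one_mul_theta_two_zero [TopologicalSpace R]
    [IsTopologicalRing R] [T2Space R] (x y : Rˣ) :
    HasSum (fun p : ℤ × ℤ => monomial (thetaExp 1 0 (p.1 + p.2) + thetaExp 1 0 (p.1 - p.2 - 1))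
        (((-x) ^ (p.1 + p.2) * (-y) ^ (p.1 - p.2 - 1) : Rˣ) : R))
      (-(C ((y⁻¹ : Rˣ) : R) * (theta 1 1 (x * y) * theta 2 0 (x / y)))) := by
  refine ((hasSum_theta_mul_theta one_ne_zero two_ne_zero 1 0 (x * y) (x / y)).mul_left
    (C ((y⁻¹ : Rˣ) : R))).neg.congr_fun fun p => ?_
  have hexp : thetaExp 1 0 (p.1 + p.2) + thetaExp 1 0 (p.1 - p.2 - 1)
      = thetaExp 1 1 p.1 + thetaExp 2 0 p.2 := by
    have := two_mul_thetaExp 1 0 (p.1 + p.2)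
    have := two_mul_thetaExp 1 0 (p.1 - p.2 - 1)
    have := two_mul_thetaExp 1 1 p.1
    have := two_mul_thetaExp 2 0 p.2
    zify
    push_cast at *
    linarith
  have hsign : (-1 : Rˣ) ^ (p.1 + p.2) * (-1) ^ (p.1 - p.2 - 1) = -1 := by
    rw [← zpow_add]
    exact Odd.neg_one_zpow ⟨p.1 - 1, by ring⟩
  rw [hexp, ← neg_one_mul x, ← neg_one_mul y, mul_zpow, mul_zpow, mul_mul_mul_comm, hsign,
    zpow_sub_one, zpow_add, zpow_sub, ← mul_assoc (x ^ p.1 * _), mul_mul_mul_comm, ← mul_zpow,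
    ← div_eq_mul_inv (x ^ p.2), ← div_zpow, ← monomial_zero_eq_C_apply, monomial_mul_monomial,
    zero_add, ← Units.val_mul, ← map_neg, neg_one_mul, Units.val_neg, mul_comm y⁻¹]

/-- The terms with `a + b` even and those with `a + b` odd in the double series over `(a, b)` for
the left-hand side give the two products on the right-hand side. -/
theorem theta_neg_mul_theta_neg (x y : Rˣ) :
    theta 1 0 (-x) * theta 1 0 (-y) = theta 2 0 (x * y) * theta 1 1 (x / y) -
      C ((y⁻¹ : Rˣ) : R) * (theta 1 1 (x * y) * theta 2 0 (x / y)) := by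
  let _ : TopologicalSpace R := ⊥
  have _ : DiscreteTopology R := ⟨rfl⟩
  let f : ℤ × ℤ → R⟦X⟧ := fun p => monomial (thetaExp 1 0 p.1 + thetaExp 1 0 p.2)
    (((-x) ^ p.1 * (-y) ^ p.2 : Rˣ) : R)
  have hinj0 : Function.Injective fun p : ℤ × ℤ => (p.1 + p.2, p.1 - p.2) := fun p q h => by
    rw [Prod.mk.injEq] at h
    exact Prod.ext (by omega) (by omega)
  have hinj1 : Function.Injective fun p : ℤ × ℤ => (p.1 + p.2, p.1 - p.2 - 1) := fun p q h => by
    rw [Prod.mk.injEq] at h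
    exact Prod.ext (by omega) (by omega)
  have heven := hinj0.hasSum_range_iff (f := f).2 (hasSum_theta_two_zero_mul_theta_one_one x y)
  have hodd := hinj1.hasSum_range_iff (f := f).2
    (hasSum_neg_C_mul_theta_one_one_mul_theta_two_zero x y)
  rw [sub_eq_add_neg]
  exact HasSum.unique (f := f)
    (hasSum_theta_mul_theta one_ne_zero one_ne_zero 0 0 (-x) (-y))
    (heven.add_isCompl isCompl_range_add_sub hodd)

end Theta

section CubicTheta

variable {R : Type*} [CommRing R]

theorem eulerProd_mul_qPoch_neg {m : ℕ} (hm : 0 < m) :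
    eulerProd R m * (qPoch (-X ^ m) (X ^ (2 * m)) * qPoch (-X ^ (2 * m)) (X ^ (2 * m)))
      = eulerProd R (2 * m) := by
  have hX : (X : R⟦X⟧) ∣ X ^ m := dvd_pow_self X hm.ne'
  rw [eulerProd, eulerProd, mul_comm 2 m, pow_mul, ← qPoch_mul_qPoch_neg hX,
    ← prod_range_qPoch hX (k := 2) two_pos (a := -X ^ m)]
  simp [prod_range_succ, ← sq]

theorem theta_four_two_one_mul_qPoch :
    theta 4 2 (1 : Rˣ) * qPoch (-X ^ 6) (X ^ 6) = qPoch (-X ^ 2) (X ^ 2) * eulerProd R 6 := by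
  have hX : (X : R⟦X⟧) ∣ X ^ 2 := dvd_pow_self X two_ne_zero
  rw [theta_eq_qPoch_mul, ← prod_range_qPoch hX (k := 3) three_pos]
  simp only [prod_range_succ, prod_range_zero, Units.val_one, inv_one, map_one]
  ring_nf

theorem theta_one_five_one_mul_qPoch :
    theta 1 5 (1 : Rˣ) * qPoch (-X ^ 3) (X ^ 6) = qPoch (-X) (X ^ 2) * eulerProd R 6 := by
  have hX : (X : R⟦X⟧) ∣ X ^ 2 := dvd_pow_self X two_ne_zero
  rw [theta_eq_qPoch_mul, ← prod_range_qPoch hX (k := 3) three_pos]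
  simp only [prod_range_succ, prod_range_zero, Units.val_one, inv_one, map_one]
  ring_nf

variable {w : Rˣ}

theorem inv_eq_sq_of_cube_root (hw : 1 + (w : R) + (w : R) ^ 2 = 0) : w⁻¹ = w ^ 2 := by
  refine inv_eq_of_mul_eq_one_right (Units.ext ?_)
  push_cast
  linear_combination ((w : R) - 1) * hw

theorem qPoch_C_mul_mul_qPoch_C_inv_mul (hw : 1 + (w : R) + (w : R) ^ 2 = 0) {a Q : R⟦X⟧}
    (hQ : X ∣ Q) :
    qPoch (C (w : R) * a) Q * qPoch (C ((w⁻¹ : Rˣ) : R) * a) Q * qPoch a Q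
      = qPoch (a ^ 3) (Q ^ 3) := by
  have hwC : 1 + C (w : R) + C (w : R) ^ 2 = 0 := by
    rw [← map_pow, ← map_one C, ← map_add, ← map_add, hw, map_zero]
  rw [← qPoch_mul_cube_roots hQ hwC, inv_eq_sq_of_cube_root hw, Units.val_pow_eq_pow_val, map_pow]
  ring

theorem theta_one_zero_neg (u : Rˣ) :
    theta 1 0 (-u) = C (1 - ((u⁻¹ : Rˣ) : R)) *
      (qPoch (C (u : R) * X) X * qPoch (C ((u⁻¹ : Rˣ) : R) * X) X * eulerProd R 1) := by
  rw [theta_eq_qPoch_mul, inv_neg]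
  simp only [Units.val_neg, map_neg, neg_mul, neg_neg, pow_zero, mul_one, add_zero, pow_one]
  rw [qPoch_eq_one_sub_mul (a := C _) dvd_rfl, map_sub, map_one]
  ring

theorem theta_one_zero_neg_cube_root (hw : 1 + (w : R) + (w : R) ^ 2 = 0) :
    theta 1 0 (-w) = C (1 - ((w⁻¹ : Rˣ) : R)) * eulerProd R 3 := by
  have h := qPoch_C_mul_mul_qPoch_C_inv_mul hw (a := X) (dvd_refl X)
  rw [theta_one_zero_neg, eulerProd, eulerProd, pow_one, h]

theorem theta_one_one_mul_qPoch (hw : 1 + (w : R) + (w : R) ^ 2 = 0) :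
    theta 1 1 w * qPoch (-X) (X ^ 2) = qPoch (-X ^ 3) (X ^ 6) * eulerProd R 2 := by
  have h := qPoch_C_mul_mul_qPoch_C_inv_mul hw (a := -X) (dvd_pow_self (X : R⟦X⟧) two_ne_zero)
  rw [Odd.neg_pow (by decide), ← pow_mul] at h
  rw [theta_eq_qPoch_mul, ← h]
  ring_nf

theorem theta_two_zero_mul_qPoch (hw : 1 + (w : R) + (w : R) ^ 2 = 0) :
    theta 2 0 w * qPoch (-X ^ 2) (X ^ 2)
      = C (1 + ((w⁻¹ : Rˣ) : R)) * (qPoch (-X ^ 6) (X ^ 6) * eulerProd R 2) := by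
  have hX : (X : R⟦X⟧) ∣ X ^ 2 := dvd_pow_self X two_ne_zero
  have h := qPoch_C_mul_mul_qPoch_C_inv_mul hw (a := -X ^ 2) hX
  rw [Odd.neg_pow (by decide), ← pow_mul] at h
  rw [theta_eq_qPoch_mul, ← h, pow_zero, mul_one, add_zero,
    qPoch_eq_one_sub_mul (a := -C ((w⁻¹ : Rˣ) : R)) hX, map_add, map_one]
  ring_nf

theorem eulerProd_three_mul_theta_one_one (hw : 1 + (w : R) + (w : R) ^ 2 = 0) :
    eulerProd R 3 * theta 1 1 w = eulerProd R 1 * theta 4 2 1 := by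
  have h1 := eulerProd_mul_qPoch_neg (R := R) one_pos
  have h3 := eulerProd_mul_qPoch_neg (R := R) three_pos
  simp only [pow_one, mul_one, Nat.reduceMul] at h1 h3
  have hunit : IsUnit (qPoch (-X) (X ^ 2) * qPoch (-X ^ 6) (X ^ 6) : R⟦X⟧) :=
    (isUnit_qPoch (dvd_neg.2 dvd_rfl)).mul
      (isUnit_qPoch (dvd_neg.2 (dvd_pow_self X (by decide))))
  refine hunit.mul_left_cancel ?_
  linear_combination eulerProd R 3 * qPoch (-X ^ 6) (X ^ 6) * theta_one_one_mul_qPoch hw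
    + eulerProd R 2 * h3 - eulerProd R 6 * h1
    - eulerProd R 1 * qPoch (-X) (X ^ 2) * theta_four_two_one_mul_qPoch (R := R)

theorem eulerProd_three_mul_theta_two_zero (hw : 1 + (w : R) + (w : R) ^ 2 = 0) :
    eulerProd R 3 * theta 2 0 w = C (1 + ((w⁻¹ : Rˣ) : R)) * (eulerProd R 1 * theta 1 5 1) := by
  have h1 := eulerProd_mul_qPoch_neg (R := R) one_pos
  have h3 := eulerProd_mul_qPoch_neg (R := R) three_pos
  simp only [pow_one, mul_one, Nat.reduceMul] at h1 h3
  have hunit : IsUnit (qPoch (-X ^ 2) (X ^ 2) * qPoch (-X ^ 3) (X ^ 6) : R⟦X⟧) :=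
    (isUnit_qPoch (dvd_neg.2 (dvd_pow_self X (by decide)))).mul
      (isUnit_qPoch (dvd_neg.2 (dvd_pow_self X (by decide))))
  refine hunit.mul_left_cancel ?_
  linear_combination eulerProd R 3 * qPoch (-X ^ 3) (X ^ 6) * theta_two_zero_mul_qPoch hw
    + C (1 + ((w⁻¹ : Rˣ) : R)) * (eulerProd R 2 * h3 - eulerProd R 6 * h1
    - eulerProd R 1 * qPoch (-X ^ 2) (X ^ 2) * theta_one_five_one_mul_qPoch (R := R))

/-- The two-variable cubic theta function
`c(q, z) = ∑ q ^ (m ^ 2 + m n + n ^ 2 + m + n) z ^ (n - m)` of Hirschhorn, Garvan and Borwein, as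
a power series in `q = X`; its two summands collect the terms with `n - m` odd and even. -/
noncomputable def cubicTheta (z : Rˣ) : R⟦X⟧ :=
  C (z : R) * (theta 2 0 (z ^ 2) * theta 4 2 1) + theta 1 1 (z ^ 2) * theta 1 5 1

theorem C_mul_eulerProd_mul_theta_mul_theta (hw : 1 + (w : R) + (w : R) ^ 2 = 0) (z : Rˣ) :
    C (z : R) * (eulerProd R 3 * (theta 1 0 (-(z * w⁻¹)) * theta 1 0 (-(z * w))))
      = eulerProd R 1 * cubicTheta z := by
  have hx : z * w⁻¹ * (z * w) = z ^ 2 := by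
    rw [mul_mul_mul_comm, inv_mul_cancel, mul_one, sq]
  have hy : z * w⁻¹ / (z * w) = w := by
    rw [mul_div_mul_left_eq_div, inv_eq_sq_of_cube_root hw, sq, mul_div_cancel_right]
  have hc : C (z : R) * C (((z * w)⁻¹ : Rˣ) : R) * C (1 + ((w⁻¹ : Rˣ) : R)) = -1 := by
    rw [← map_mul, ← map_mul, ← Units.val_mul, mul_inv, mul_inv_cancel_left,
      inv_eq_sq_of_cube_root hw, ← map_one C, ← map_neg]
    congr 1
    push_cast
    linear_combination ((w : R) ^ 2 - w + 1) * hw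
  rw [theta_neg_mul_theta_neg, hx, hy, cubicTheta]
  linear_combination C (z : R) * theta 2 0 (z ^ 2) * eulerProd_three_mul_theta_one_one hw
    - C (z : R) * C (((z * w)⁻¹ : Rˣ) : R) * theta 1 1 (z ^ 2) *
        eulerProd_three_mul_theta_two_zero hw
    - theta 1 1 (z ^ 2) * eulerProd R 1 * theta 1 5 1 * hc

theorem dvd_of_dvd_three_mul_sq_add_sq {p : ℕ} [Fact p.Prime] (hp : ¬IsSquare (-3 : ZMod p))
    {x y : ℤ} (h : (p : ℤ) ∣ 3 * x ^ 2 + y ^ 2) : (p : ℤ) ∣ x := by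
  rw [← ZMod.intCast_zmod_eq_zero_iff_dvd] at h ⊢
  push_cast at h
  by_contra hx
  refine hp ⟨y / x, ?_⟩
  field_simp
  linear_combination -h

theorem dvd_two_mul_add_one_of_thetaExp_eq {p : ℕ} [Fact p.Prime] (hp : ¬IsSquare (-3 : ZMod p))
    {i m : ℤ} (h : p ∣ 3 * (thetaExp 2 0 i + thetaExp 4 2 m) + 1) : (p : ℤ) ∣ 2 * i + 1 := by
  have hi := two_mul_thetaExp 2 0 i
  have hm := two_mul_thetaExp 4 2 m
  have heq : 3 * (2 * i + 1) ^ 2 + (6 * m + 1) ^ 2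
      = 4 * ((3 * (thetaExp 2 0 i + thetaExp 4 2 m) + 1 : ℕ) : ℤ) := by
    push_cast at *
    linear_combination -6 * hi - 6 * hm
  exact dvd_of_dvd_three_mul_sq_add_sq hp (heq ▸ (Int.natCast_dvd_natCast.2 h).mul_left 4)

theorem dvd_of_thetaExp_eq {p : ℕ} [Fact p.Prime] (hp : ¬IsSquare (-3 : ZMod p)) {i m : ℤ}
    (h : p ∣ 3 * (thetaExp 1 1 i + thetaExp 1 5 m) + 1) : (p : ℤ) ∣ i := by
  have hi := two_mul_thetaExp 1 1 i
  have hm := two_mul_thetaExp 1 5 m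
  have heq : 3 * i ^ 2 + (3 * m - 1) ^ 2
      = ((3 * (thetaExp 1 1 i + thetaExp 1 5 m) + 1 : ℕ) : ℤ) := by
    push_cast at *
    linarith
  exact dvd_of_dvd_three_mul_sq_add_sq hp (heq ▸ Int.natCast_dvd_natCast.2 h)

/-- Each term `q ^ n z ^ k` of the cubic theta series has `4 (3 n + 1) = 3 k ^ 2 + y ^ 2` for some
integer `y`; as `-3` is not a square mod `p`, this forces `p ∣ k` whenever `p ∣ 3 n + 1`. -/
theorem coeff_cubicTheta_congr {p : ℕ} [Fact p.Prime] (hp : ¬IsSquare (-3 : ZMod p)) {n : ℕ}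
    (hn : p ∣ 3 * n + 1) {z z' : Rˣ} (hz : z ^ p = z' ^ p) :
    coeff n (cubicTheta z) = coeff n (cubicTheta z') := by
  have hpow {k : ℤ} (hk : (p : ℤ) ∣ k) : z ^ k = z' ^ k := by
    obtain ⟨l, rfl⟩ := hk
    rw [zpow_mul, zpow_mul, zpow_natCast, zpow_natCast, hz]
  have hsq (t : Rˣ) (i : ℤ) : (t ^ 2) ^ i = t ^ (2 * i) := by
    rw [zpow_mul, zpow_ofNat]
  have hodd := coeff_C_mul_theta_mul_theta_congr (n := n) (c := (z : R)) (c' := (z' : R))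
    (u := z ^ 2) (u' := z' ^ 2) (β := 0) (δ := 2) two_ne_zero four_ne_zero 1 fun i m him => by
      have hdvd := dvd_two_mul_add_one_of_thetaExp_eq hp (him.symm ▸ hn)
      rw [← Units.val_mul, ← Units.val_mul, hsq, hsq, ← zpow_one_add, ← zpow_one_add, add_comm,
        hpow hdvd]
  have heven := coeff_C_mul_theta_mul_theta_congr (n := n) (c := (1 : R)) (c' := (1 : R))
    (u := z ^ 2) (u' := z' ^ 2) (β := 1) (δ := 5) one_ne_zero one_ne_zero 1 fun i m him => by
      have hdvd := dvd_of_thetaExp_eq hp (him.symm ▸ hn)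
      rw [hsq, hsq, hpow (hdvd.mul_left 2)]
  rw [map_one, one_mul, one_mul] at heven
  rw [cubicTheta, cubicTheta, map_add, map_add, hodd, heven]

end CubicTheta

section DualNumber

variable {R S : Type*} [CommRing R] [CommRing S]

theorem map_theta (f : R →+* S) (α β : ℕ) (u : Rˣ) :
    (theta α β u).map f = theta α β (Units.map (f : R →* S) u) := by
  simp only [theta_eq_qPoch_mul, map_mul, map_qPoch, map_eulerProd, map_neg, map_pow,
    PowerSeries.map_C, PowerSeries.map_X, ← map_inv, Units.coe_map, MonoidHom.coe_coe]

theorem C_mul_eq_C_mul_of_map_eq (f : R →+* S) {e : R} (he : ∀ a, f a = 0 → e * a = 0)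
    {F G : R⟦X⟧} (h : F.map f = G.map f) : C e * F = C e * G := by
  ext n
  have hn : f (coeff n F - coeff n G) = 0 := by
    rw [map_sub, ← coeff_map, ← coeff_map, h, sub_self]
  rw [coeff_C_mul, coeff_C_mul, ← sub_eq_zero, ← mul_sub, he _ hn]

theorem cubicTheta_mul_of_map_eq_one {w u : Rˣ} (hw : 1 + (w : R) + (w : R) ^ 2 = 0) (f : R →+* S)
    (hu : f u = 1) (hker : ∀ a, f a = 0 → (1 - ((u⁻¹ : Rˣ) : R)) * a = 0) :
    cubicTheta (w * u) = C (1 - ((u⁻¹ : Rˣ) : R)) *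
      (C ((w : R) - (w : R) ^ 2) * (eulerProd R 1 ^ 2 * eulerProd R 3 ^ 2)) := by
  have hw2 : 1 + ((w ^ 2 : Rˣ) : R) + ((w ^ 2 : Rˣ) : R) ^ 2 = 0 := by
    push_cast
    linear_combination ((w : R) ^ 2 - w + 1) * hw
  have hinv : (w ^ 2)⁻¹ = w := by rw [← inv_eq_sq_of_cube_root hw, inv_inv]
  have hC : C (w : R) * C (1 - (w : R)) = C ((w : R) - (w : R) ^ 2) := by
    rw [← map_mul, mul_one_sub, sq]
  have hx : w * u * w⁻¹ = u := by rw [mul_comm w, mul_inv_cancel_right]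
  have hy : w * u * w = w ^ 2 * u := by rw [mul_right_comm, sq]
  have hu' : f ((u⁻¹ : Rˣ) : R) = 1 := by
    have h := map_mul f ((u⁻¹ : Rˣ) : R) u
    rwa [Units.inv_mul, map_one, hu, mul_one, eq_comm] at h
  have hneg : Units.map (f : R →* S) (-(w ^ 2 * u)) = Units.map (f : R →* S) (-w ^ 2) :=
    Units.ext (by simp [hu])
  have hmap : (C ((w * u : Rˣ) : R) * (qPoch (C (u : R) * X) X *
        qPoch (C ((u⁻¹ : Rˣ) : R) * X) X * theta 1 0 (-(w ^ 2 * u)))).map f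
      = (C (w : R) * (eulerProd R 1 ^ 2 * theta 1 0 (-w ^ 2))).map f := by
    simp only [map_mul, map_theta, map_qPoch, PowerSeries.map_C, PowerSeries.map_X,
      Units.val_mul, hneg, hu, hu', map_one, mul_one, one_mul, eulerProd, pow_one, sq (qPoch _ _)]
  have hred := C_mul_eq_C_mul_of_map_eq f hker hmap
  have hprod := C_mul_eulerProd_mul_theta_mul_theta hw (w * u)
  rw [hx, hy, theta_one_zero_neg u] at hprod
  rw [theta_one_zero_neg_cube_root hw2, hinv] at hred
  refine ((isUnit_eulerProd one_pos).mul_right_inj).1 ?_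
  linear_combination -hprod + eulerProd R 3 * eulerProd R 1 * hred +
    C (1 - ((u⁻¹ : Rˣ) : R)) * eulerProd R 1 ^ 3 * eulerProd R 3 ^ 2 * hC

theorem mul_coeff_eulerProd_sq_mul_eulerProd_sq {p : ℕ} [Fact p.Prime]
    (hp : ¬IsSquare (-3 : ZMod p)) {n : ℕ} (hn : p ∣ 3 * n + 1) {w u : Rˣ}
    (hw : 1 + (w : R) + (w : R) ^ 2 = 0) (hup : u ^ p = 1) (f : R →+* S) (hu : f u = 1)
    (hker : ∀ a, f a = 0 → (1 - ((u⁻¹ : Rˣ) : R)) * a = 0) :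
    (1 - ((u⁻¹ : Rˣ) : R)) *
      (((w : R) - (w : R) ^ 2) * coeff n (eulerProd R 1 ^ 2 * eulerProd R 3 ^ 2)) = 0 := by
  have hzero : cubicTheta w = 0 := by
    simpa using cubicTheta_mul_of_map_eq_one (u := 1) hw (RingHom.id R) rfl (by simp)
  have hcoeff : coeff n (cubicTheta (w * u)) = coeff n (cubicTheta w) :=
    coeff_cubicTheta_congr hp hn (by rw [mul_pow, hup, mul_one])
  rw [← coeff_C_mul, ← coeff_C_mul, ← cubicTheta_mul_of_map_eq_one hw f hu hker, hcoeff, hzero,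
    map_zero]

theorem sub_sq_ne_zero_of_cube_root {p : ℕ} [CharP R p] (hp : ¬IsSquare (-3 : ZMod p)) {w : R}
    (hw : 1 + w + w ^ 2 = 0) : w - w ^ 2 ≠ 0 := by
  intro h
  have h3 : ((3 : ℕ) : R) = 0 := by
    push_cast
    linear_combination (-(w - w ^ 2)) * h + (w ^ 2 - 3 * w + 3) * hw
  have h3' : ((3 : ℕ) : ZMod p) = 0 :=
    (ZMod.natCast_eq_zero_iff 3 p).2 ((CharP.cast_eq_zero_iff R p 3).1 h3)
  refine hp ⟨0, ?_⟩
  push_cast at h3'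
  rw [h3', neg_zero, mul_zero]

/-- The unit `1 + ε` of the dual numbers; evaluating a series at `w * oneAddEps R` differentiates it
at `w`. -/
def oneAddEps (R : Type*) [CommRing R] : R[ε]ˣ where
  val := 1 + ε
  inv := 1 - ε
  val_inv := by ext <;> simp
  inv_val := by ext <;> simp

theorem oneAddEps_pow_char (p : ℕ) [CharP R p] : oneAddEps R ^ p = 1 := by
  ext <;> simp [oneAddEps]

theorem coeff_eulerProd_sq_mul_eulerProd_sq [NoZeroDivisors R] {p : ℕ} [Fact p.Prime] [CharP R p]
    (hp : ¬IsSquare (-3 : ZMod p)) {w : R} (hw : 1 + w + w ^ 2 = 0) {n : ℕ}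
    (hn : p ∣ 3 * n + 1) : coeff n (eulerProd R 1 ^ 2 * eulerProd R 3 ^ 2) = 0 := by
  let inl : R →+* R[ε] := TrivSqZeroExt.inlHom R R
  have hw' : 1 + inl w + inl w ^ 2 = 0 := by
    rw [← map_one inl, ← map_pow, ← map_add, ← map_add, hw, map_zero]
  have hunit : inl w * inl (w ^ 2) = 1 := by
    rw [← map_mul, ← map_one inl]
    congr 1
    linear_combination (w - 1) * hw
  have hinv : 1 - (((oneAddEps R)⁻¹ : R[ε]ˣ) : R[ε]) = ε := sub_sub_cancel 1 ε
  have h := mul_coeff_eulerProd_sq_mul_eulerProd_sq hp hn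
    (w := Units.mkOfMulEqOne _ _ hunit) hw' (oneAddEps_pow_char p)
    (TrivSqZeroExt.fstHom R R R : R[ε] →+* R) (by simp [oneAddEps])
    fun a ha => by
      rw [hinv]
      have ha' : a.fst = 0 := ha
      ext <;> simp [ha']
  rw [hinv, ← map_eulerProd inl 1, ← map_eulerProd inl 3, ← map_pow, ← map_pow, ← map_mul,
    coeff_map, Units.val_mkOfMulEqOne, ← map_pow, ← map_sub, ← map_mul] at h
  have hsnd : (w - w ^ 2) * coeff n (eulerProd R 1 ^ 2 * eulerProd R 3 ^ 2) = 0 := by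
    simpa [inl] using congrArg TrivSqZeroExt.snd h
  exact (mul_eq_zero.1 hsnd).resolve_left (sub_sq_ne_zero_of_cube_root hp hw)

end DualNumber

section WeightedMultisets

variable {ι : Type*} {wt : ι → ℕ}

/-- The multisets of elements of `S` of total weight `n`. -/
def weightedMultisets (wt : ι → ℕ) (S : Finset ι) (n : ℕ) : Set (Multiset ι) :=
  {m | (∀ x ∈ m, x ∈ S) ∧ (m.map wt).sum = n}

theorem mem_weightedMultisets {S : Finset ι} {n : ℕ} {m : Multiset ι} :
    m ∈ weightedMultisets wt S n ↔ (∀ x ∈ m, x ∈ S) ∧ (m.map wt).sum = n := Iff.rfl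

theorem weightedMultisets_empty_zero : weightedMultisets wt ∅ 0 = {0} := by
  ext m
  simp only [mem_weightedMultisets, notMem_empty, imp_false, ← Multiset.eq_zero_iff_forall_notMem,
    Set.mem_singleton_iff, and_iff_left_iff_imp]
  rintro rfl
  rfl

theorem weightedMultisets_empty_succ (n : ℕ) : weightedMultisets wt ∅ (n + 1) = ∅ := by
  ext m
  simp only [mem_weightedMultisets, notMem_empty, imp_false, ← Multiset.eq_zero_iff_forall_notMem,
    Set.mem_empty_iff_false, iff_false]
  rintro ⟨rfl, h⟩
  exact n.succ_ne_zero h.symm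

variable {a : ι} {S : Finset ι}

theorem weightedMultisets_insert_of_lt [DecidableEq ι] {n : ℕ} (hn : n < wt a) :
    weightedMultisets wt (insert a S) n = weightedMultisets wt S n := by
  ext m
  refine and_congr_left fun hm => forall₂_congr fun x hx => ?_
  refine ⟨fun h => (mem_insert.1 h).resolve_left ?_, mem_insert_of_mem⟩
  rintro rfl
  exact hn.not_ge (hm ▸ Multiset.single_le_sum (fun _ _ => Nat.zero_le _) _
    (Multiset.mem_map_of_mem wt hx))

theorem weightedMultisets_insert_add [DecidableEq ι] (n : ℕ) :
    weightedMultisets wt (insert a S) (n + wt a)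
      = weightedMultisets wt S (n + wt a) ∪
        Multiset.cons a '' weightedMultisets wt (insert a S) n := by
  ext m
  constructor
  · rintro ⟨hmem, hsum⟩
    by_cases ha : a ∈ m
    · obtain ⟨m, rfl⟩ := Multiset.exists_cons_of_mem ha
      rw [Multiset.map_cons, Multiset.sum_cons, add_comm, Nat.add_right_cancel_iff] at hsum
      exact Or.inr ⟨m, ⟨fun x hx => hmem x (Multiset.mem_cons_of_mem hx), hsum⟩, rfl⟩
    · exact Or.inl ⟨fun x hx => (mem_insert.1 (hmem x hx)).resolve_left
        (ne_of_mem_of_not_mem hx ha), hsum⟩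
  · rintro (⟨hmem, hsum⟩ | ⟨m, ⟨hmem, hsum⟩, rfl⟩)
    · exact ⟨fun x hx => mem_insert_of_mem (hmem x hx), hsum⟩
    · refine ⟨fun x hx => ?_, by rw [Multiset.map_cons, Multiset.sum_cons, hsum, add_comm]⟩
      obtain rfl | hx := Multiset.mem_cons.1 hx
      exacts [mem_insert_self x S, hmem x hx]

theorem finite_weightedMultisets (hpos : ∀ x ∈ S, 0 < wt x) (n : ℕ) :
    (weightedMultisets wt S n).Finite := by
  classical
  induction S using Finset.induction_on generalizing n with
  | empty =>
    cases n with
    | zero => rw [weightedMultisets_empty_zero]; exact Set.finite_singleton 0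
    | succ n => rw [weightedMultisets_empty_succ]; exact Set.finite_empty
  | insert a S _ ih =>
    have hS := ih fun x hx => hpos x (mem_insert_of_mem hx)
    have ha := hpos a (mem_insert_self a S)
    induction n using Nat.strong_induction_on with
    | _ n ihn =>
      rcases lt_or_ge n (wt a) with hn | hn
      · rw [weightedMultisets_insert_of_lt hn]
        exact hS n
      · obtain ⟨n, rfl⟩ := Nat.exists_eq_add_of_le' hn
        rw [weightedMultisets_insert_add]
        exact (hS _).union ((ihn n (by omega)).image _)

theorem ncard_weightedMultisets_insert_add [DecidableEq ι] (hpos : ∀ x ∈ insert a S, 0 < wt x)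
    (ha : a ∉ S) (n : ℕ) : (weightedMultisets wt (insert a S) (n + wt a)).ncard
      = (weightedMultisets wt S (n + wt a)).ncard +
        (weightedMultisets wt (insert a S) n).ncard := by
  have hdisj : Disjoint (weightedMultisets wt S (n + wt a))
      (Multiset.cons a '' weightedMultisets wt (insert a S) n) := by
    rw [Set.disjoint_left]
    rintro _ hm ⟨m, -, rfl⟩
    exact ha (hm.1 a (Multiset.mem_cons_self a m))
  rw [weightedMultisets_insert_add, Set.ncard_union_eq hdisj
    (finite_weightedMultisets (fun x hx => hpos x (mem_insert_of_mem hx)) _)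
    ((finite_weightedMultisets hpos n).image _),
    Set.ncard_image_of_injective _ fun _ _ => (Multiset.cons_inj_right a).1]

theorem mk_ncard_weightedMultisets_insert_mul [DecidableEq ι] (R : Type*) [CommRing R]
    (hpos : ∀ x ∈ insert a S, 0 < wt x) (ha : a ∉ S) :
    (PowerSeries.mk fun n => ((weightedMultisets wt (insert a S) n).ncard : R)) * (1 - X ^ wt a)
      = PowerSeries.mk fun n => ((weightedMultisets wt S n).ncard : R) := by
  ext n
  rw [mul_one_sub, map_sub, coeff_mul_X_pow', coeff_mk, coeff_mk]
  split_ifs with hn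
  · obtain ⟨n, rfl⟩ := Nat.exists_eq_add_of_le' hn
    rw [Nat.add_sub_cancel, coeff_mk, ncard_weightedMultisets_insert_add hpos ha, Nat.cast_add,
      add_sub_cancel_right]
  · rw [sub_zero, weightedMultisets_insert_of_lt (not_le.1 hn), coeff_mk]

theorem mk_ncard_weightedMultisets_mul_prod (R : Type*) [CommRing R]
    (hpos : ∀ x ∈ S, 0 < wt x) :
    (PowerSeries.mk fun n => ((weightedMultisets wt S n).ncard : R)) * ∏ x ∈ S, (1 - X ^ wt x)
      = 1 := by
  classical
  induction S using Finset.induction_on with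
  | empty =>
    rw [prod_empty, mul_one]
    ext (_ | n)
    · simp [weightedMultisets_empty_zero]
    · simp [weightedMultisets_empty_succ, coeff_one]
  | insert a S ha ih =>
    rw [prod_insert ha, ← mul_assoc, mk_ncard_weightedMultisets_insert_mul R hpos ha,
      ih fun x hx => hpos x (mem_insert_of_mem hx)]

end WeightedMultisets

section ColoredPartitions

theorem numColors_le (k r m : ℕ) : numColors k r m ≤ 2 * k := by
  rw [numColors]
  split_ifs <;> omega

/-- The colored parts of size at most `N`, as pairs (part, color). -/
def coloredParts (k r N : ℕ) : Finset (ℕ × ℕ) :=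
  {x ∈ Ico 1 (N + 1) ×ˢ range (2 * k) | x.2 < numColors k r x.1}

theorem mem_coloredParts {k r N : ℕ} {x : ℕ × ℕ} :
    x ∈ coloredParts k r N ↔ (0 < x.1 ∧ x.1 ≤ N) ∧ x.2 < numColors k r x.1 := by
  have := numColors_le k r x.1
  rw [coloredParts, mem_filter, mem_product, mem_Ico, mem_range]
  omega

theorem coloredPartitionCount_eq_ncard {k r n N : ℕ} (hn : n ≤ N) :
    coloredPartitionCount k r n
      = (weightedMultisets Prod.fst (coloredParts k r N) n).ncard := by
  refine Nat.card_congr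
    { toFun := fun p => ⟨p.parts, fun x hx => mem_coloredParts.2
        ⟨⟨p.parts_pos x hx, le_trans ?_ hn⟩, p.color_lt x hx⟩, p.parts_sum⟩
      invFun := fun m => ⟨m, fun x hx => (mem_coloredParts.1 (m.2.1 x hx)).1.1,
        fun x hx => (mem_coloredParts.1 (m.2.1 x hx)).2, m.2.2⟩
      left_inv := fun _ => rfl
      right_inv := fun _ => rfl }
  exact p.parts_sum ▸ Multiset.single_le_sum (fun _ _ => Nat.zero_le _) _
    (Multiset.mem_map_of_mem Prod.fst hx)

theorem prod_coloredParts {M : Type*} [CommMonoid M] (f : ℕ → M) (k r N : ℕ) :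
    ∏ x ∈ coloredParts k r N, f x.1 = ∏ m ∈ range N, f (m + 1) ^ numColors k r (m + 1) := by
  have hcolors (m : ℕ) :
      {c ∈ range (2 * k) | c < numColors k r m} = range (numColors k r m) := by
    have := numColors_le k r m
    ext c
    rw [mem_filter, mem_range, mem_range]
    omega
  rw [coloredParts, prod_filter, prod_product, prod_Ico_eq_prod_range, Nat.add_sub_cancel]
  refine prod_congr rfl fun m _ => ?_
  simp only [← prod_filter, hcolors, prod_const, card_range, add_comm 1]

theorem prod_range_mul_pow_numColors {M : Type*} [CommMonoid M] (f : ℕ → M) (k : ℕ) {r : ℕ}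
    (hr : 0 < r) (N : ℕ) :
    ∏ m ∈ range (r * N), f (m + 1) ^ numColors k r (m + 1)
      = (∏ m ∈ range (r * N), f (m + 1)) ^ k * (∏ i ∈ range N, f (r * (i + 1))) ^ k := by
  obtain ⟨s, rfl⟩ : ∃ s, r = s + 1 := Nat.exists_eq_add_one.2 hr
  induction N with
  | zero => simp
  | succ N ih =>
    have hk : ∀ j ∈ range s, f ((s + 1) * N + j + 1) ^ numColors k (s + 1) ((s + 1) * N + j + 1)
        = f ((s + 1) * N + j + 1) ^ k := fun j hj => by
      rw [numColors, if_neg]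
      rw [add_assoc, Nat.dvd_add_right (dvd_mul_right _ _)]
      exact Nat.not_dvd_of_pos_of_lt j.succ_pos (Nat.succ_lt_succ (mem_range.1 hj))
    have hlast : numColors k (s + 1) ((s + 1) * N + s + 1) = k + k := by
      rw [numColors, if_pos ⟨N + 1, rfl⟩, two_mul]
    rw [mul_add_one, ← add_assoc, prod_range_succ, prod_range_succ, prod_range_add, prod_range_add,
      ih, prod_range_succ _ N, mul_add_one (s + 1) N, ← add_assoc, prod_congr rfl hk, hlast,
      prod_pow, pow_add, mul_pow, mul_pow, mul_pow]
    ac_rfl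

theorem eulerProd_smodEq_prod_range (R : Type*) [CommRing R] {m : ℕ} (hm : 0 < m) (N : ℕ) :
    eulerProd R m ≡ ∏ i ∈ range N, (1 - X ^ (m * (i + 1))) [SMOD span {(X : R⟦X⟧) ^ N}] := by
  simpa only [eulerProd, ← pow_mul, ← pow_add, Nat.mul_succ, add_comm] using
    qPoch_smodEq_prod_range (a := (X : R⟦X⟧) ^ m) (dvd_pow_self X hm.ne') N

theorem mk_coloredPartitionCount_mul_eulerProd (R : Type*) [CommRing R] (k : ℕ) {r : ℕ}
    (hr : 0 < r) :
    (PowerSeries.mk fun n => (coloredPartitionCount k r n : R)) *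
      (eulerProd R 1 ^ k * eulerProd R r ^ k) = 1 := by
  refine eq_of_forall_smodEq fun N => ?_
  have hN : N ≤ r * N := Nat.le_mul_of_pos_left N hr
  have hcount : (PowerSeries.mk fun n => (coloredPartitionCount k r n : R)) ≡
      PowerSeries.mk fun n => ((weightedMultisets Prod.fst (coloredParts k r (r * N)) n).ncard : R)
      [SMOD span {(X : R⟦X⟧) ^ N}] :=
    smodEq_span_X_pow_iff.2 fun n hn => by
      rw [coeff_mk, coeff_mk, coloredPartitionCount_eq_ncard (hn.le.trans hN)]
  have hone := smodEq_X_pow_of_le hN (eulerProd_smodEq_prod_range R one_pos (r * N))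
  simp only [one_mul] at hone
  have hprod := prod_range_mul_pow_numColors (fun m => 1 - (X : R⟦X⟧) ^ m) k hr N
  rw [← prod_coloredParts (fun m => 1 - (X : R⟦X⟧) ^ m)] at hprod
  have hcancel := mk_ncard_weightedMultisets_mul_prod R
    (wt := Prod.fst) (S := coloredParts k r (r * N)) fun x hx => (mem_coloredParts.1 hx).1.1
  rw [hprod] at hcancel
  rw [← hcancel]
  exact hcount.mul ((hone.pow k).mul ((eulerProd_smodEq_prod_range R hr N).pow k))

end ColoredPartitions

section Congruence

theorem coeff_pow_char_of_not_dvd {R : Type*} [CommRing R] {p : ℕ} [ExpChar R p] (F : R⟦X⟧) {m : ℕ}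
    (hm : ¬p ∣ m) : coeff m (F ^ p) = 0 := by
  have hp : p ≠ 0 := (expChar_pos R p).ne'
  have h : (F.expand p hp).map (frobenius R p) = F ^ p := MvPowerSeries.map_frobenius_expand p hp
  rw [← h, coeff_map, coeff_expand_of_not_dvd p hp F hm, map_zero]

theorem coeff_mul_pow_char_eq_zero {R : Type*} [CommRing R] {p : ℕ} [ExpChar R p] {F : R⟦X⟧}
    {n : ℕ} (hF : ∀ m, m ≡ n [MOD p] → coeff m F = 0) (G : R⟦X⟧) : coeff n (F * G ^ p) = 0 := by
  rw [coeff_mul]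
  refine sum_eq_zero fun x hx => ?_
  rw [HasAntidiagonal.mem_antidiagonal] at hx
  by_cases hd : p ∣ x.2
  · rw [hF x.1 ((Nat.modEq_iff_dvd' (by omega)).2 (by rwa [← hx, Nat.add_sub_cancel_left])),
      zero_mul]
  · rw [coeff_pow_char_of_not_dvd G hd, mul_zero]

theorem exists_one_add_add_sq_eq_zero (K : Type*) [Field K] [IsAlgClosed K] :
    ∃ w : K, 1 + w + w ^ 2 = 0 := by
  have hdeg : (Polynomial.X ^ 2 + Polynomial.X + 1 : Polynomial K).degree = 2 := by
    compute_degree!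
  obtain ⟨w, hw⟩ := IsAlgClosed.exists_root (Polynomial.X ^ 2 + Polynomial.X + 1 : Polynomial K)
    (by rw [hdeg]; exact two_ne_zero)
  refine ⟨w, ?_⟩
  simp only [Polynomial.IsRoot.def, Polynomial.eval_add, Polynomial.eval_pow, Polynomial.eval_X,
    Polynomial.eval_one] at hw
  linear_combination hw

theorem exists_mk_coloredPartitionCount_eq (R : Type*) [CommRing R] {p k : ℕ} (hk : p ∣ k + 2) :
    ∃ G : R⟦X⟧, (PowerSeries.mk fun n => (coloredPartitionCount k 3 n : R))
      = eulerProd R 1 ^ 2 * eulerProd R 3 ^ 2 * G ^ p := by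
  obtain ⟨j, hj⟩ := hk
  have hunit : IsUnit (eulerProd R 1 * eulerProd R 3) :=
    (isUnit_eulerProd one_pos).mul (isUnit_eulerProd three_pos)
  obtain ⟨V, hV⟩ := hunit.exists_right_inv
  have hVpow : eulerProd R 1 ^ (k + 2) * eulerProd R 3 ^ (k + 2) * (V ^ j) ^ p = 1 := by
    rw [← pow_mul, mul_comm j, ← hj, ← mul_pow, ← mul_pow, hV, one_pow]
  refine ⟨V ^ j, (left_inv_eq_right_inv (mk_coloredPartitionCount_mul_eulerProd R k three_pos)
    (c := eulerProd R 1 ^ 2 * eulerProd R 3 ^ 2 * (V ^ j) ^ p) ?_)⟩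
  linear_combination hVpow

theorem mainTheorem9_general {p k n : ℕ} [Fact p.Prime] (hp : ¬IsSquare (-3 : ZMod p))
    (hk : p ∣ k + 2) (hn : p ∣ 3 * n + 1) : coloredPartitionCount k 3 n ≡ 0 [MOD p] := by
  let K := AlgebraicClosure (ZMod p)
  have : CharP K p := charP_of_injective_algebraMap (algebraMap (ZMod p) K).injective p
  have : ExpChar K p := ExpChar.prime Fact.out
  obtain ⟨w, hw⟩ := exists_one_add_add_sq_eq_zero K
  obtain ⟨G, hG⟩ := exists_mk_coloredPartitionCount_eq K hk
  have hcoeff : coeff n (eulerProd K 1 ^ 2 * eulerProd K 3 ^ 2 * G ^ p) = 0 :=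
    coeff_mul_pow_char_eq_zero (fun m hm => coeff_eulerProd_sq_mul_eulerProd_sq hp hw
      ((((hm.mul_left 3).add_right 1).dvd_iff dvd_rfl).2 hn)) G
  rw [← hG, coeff_mk, CharP.cast_eq_zero_iff K p] at hcoeff
  exact Nat.modEq_zero_iff_dvd.2 hcoeff

end Congruence

theorem mainTheorem9 (n : ℕ) : coloredPartitionCount 3 3 (5 * n + 3) ≡ 0 [MOD 5] := by
  have hp : ¬IsSquare (-3 : ZMod 5) := by decide
  have : Fact (Nat.Prime 5) := ⟨Nat.prime_five⟩
  exact mainTheorem9_general hp dvd_rfl (by omega)
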